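/- Theorem. Let $n \ge 0$ be an integer. A Dyck path of size $n$ is a lattice path from $(0,0)$ to $(n,n)$ with north steps $\uparrow = (0,1)$ and east steps $\rightarrow = (1,0)$ that stays weakly above the diagonal $y = x$; let $\mathcal{D}_n$ be the set of these paths. The area vector of $D \in \mathcal{D}_n$ is $(a_1, \ldots, a_n)$, where $a_i$ is the number of full unit squares with upper edge on the line $y = i$ that lie between $D$ and the diagonal. For a set $S$ of real numbers $x_1 < \cdots < x_n$, let $([n], \preceq_S)$ be the poset on $[n] = \{1, \ldots, n\}$ in which $i \prec_S j$ if and only if $x_i + 1 < x_j$. A poset $P$ with $n$ elements is a unit interval poset if $P \cong ([n], \preceq_S)$ for some such $S$, which is then called a starting set of $P$. Let $\mathcal{P}_n$ be the set of unit interval posets with $n$ elements, up to isomorphism. The map $\psi : \mathcal{D}_n \to \mathcal{P}_n$ sends a Dyck path $D$ with area vector $(a_1, \ldots, a_n)$ to the poset $([n], \preceq)$ in which $i \prec j$ if and only if either $a_i + 2 \le a_j$, or $a_i + 1 = a_j$ and $i < j$. The map $\varphi : \mathcal{P}_n \to \mathcal{D}_n$ is defined as follows. Given $P \in \mathcal{P}_n$,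 choose a starting set $S$ of $P$ such that $S \cap S^+ = \varnothing$, where $S^+ = \{x + 1 \mid x \in S\}$, and write $S \cup S^+ = \{y_1 < \cdots < y_{2n}\}$. The $i$-th step of $\varphi(P)$ is $\uparrow$ if $y_i \in S$, and $\rightarrow$ if $y_i \in S^+$. (Such an $S$ exists, and the path does not depend on its choice.) The zeta map $\zeta : \mathcal{D}_n \to \mathcal{D}_n$ of $q,t$-Catalan combinatorics sends a Dyck path $D$ with area vector $(a_1, \ldots, a_n)$ to the path obtained as follows: for $k = 0, 1, \ldots, n$ in this order, read $a_1, \ldots, a_n$ from left to right, appending $\uparrow$ for each entry equal to $k$ and $\rightarrow$ for each entry equal to $k - 1$. Then $\varphi \circ \psi = \zeta$ as maps from $\mathcal{D}_n$ to $\mathcal{D}_n$. -/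

import Mathlib

namespace UnitInterval

open DyckStep

/-! ### Dyck paths -/

/-- Dyck paths of size `n`. A Dyck word of Mathlib is read as a lattice path from `(0, 0)`, with
`U` the north step `(0, 1)` and `D` the east step `(1, 0)`; the condition on prefixes says that
the path stays weakly above the diagonal `y = x`, and the semilength is the number of north
steps. -/
abbrev DyckPath (n : ℕ) : Type := {p : DyckWord // p.semilength = n}

/-- Going along a lattice path that starts at the point `(x, y)` weakly above the diagonal, record
for each north step, say from `(c, r)` to `(c, r + 1)`, the number `r - c` of full unit squares
with upper edge on the line `y = r + 1` between the path and the diagonal: these are the squares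
`[k, k + 1] × [r, r + 1]` with `c ≤ k < r`. -/
def areaFrom : ℕ → ℕ → List DyckStep → List ℕ
  | _, _, [] => []
  | x, y, U :: l => (y - x) :: areaFrom x (y + 1) l
  | x, y, D :: l => areaFrom (x + 1) y l

/-- The area vector of a Dyck path, as a list, from the bottom row to the top row. -/
def areaList (p : DyckWord) : List ℕ := areaFrom 0 0 p.toList

theorem length_areaFrom (x y : ℕ) (l : List DyckStep) :
    (areaFrom x y l).length = l.count U := by
  induction l generalizing x y with
  | nil => simp [areaFrom]
  | cons s l ih => cases s <;> simp [areaFrom, ih]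

theorem lt_of_mem_areaFrom (x y : ℕ) (l : List DyckStep) (a : ℕ) (ha : a ∈ areaFrom x y l) :
    a < y + l.count U := by
  induction l generalizing x y with
  | nil => simp [areaFrom] at ha
  | cons s l ih =>
    cases s
    · simp only [areaFrom, List.mem_cons] at ha
      rcases ha with rfl | ha
      · simp; omega
      · have := ih _ _ ha
        simp; omega
    · have := ih _ _ ha
      simpa using this

theorem length_areaList {n : ℕ} (p : DyckPath n) : (areaList p.1).length = n := by
  rw [areaList, length_areaFrom]
  exact p.2

/-- The area vector `(a_1, …, a_n)`, indexed from `0`. -/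
def area {n : ℕ} (p : DyckPath n) (i : Fin n) : ℕ :=
  (areaList p.1)[i.1]'(by rw [length_areaList]; exact i.2)

/-! ### The zeta map -/

/-- One reading of the area vector `a` from left to right: write a north step for each entry `k`
and an east step for each entry `k - 1`, and skip all other entries. -/
def zetaBlock (a : List ℕ) (k : ℕ) : List DyckStep :=
  a.filterMap fun v => if v = k then some U else if v + 1 = k then some D else none

/-- The steps of the image under the zeta map of a Dyck path with area vector `a`: the
concatenation of the readings for `k = 0, 1, …, n`. -/
def zetaList (a : List ℕ) : List DyckStep :=
  (List.range (a.length + 1)).flatMap (zetaBlock a)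

theorem count_U_zetaBlock (a : List ℕ) (k : ℕ) :
    (zetaBlock a k).count U = a.count k := by
  induction a with
  | nil => simp [zetaBlock]
  | cons v a ih =>
    simp only [zetaBlock] at ih ⊢
    by_cases h : v = k
    · simp [h, ih]
    · by_cases h' : v + 1 = k <;> simp [h, h', ih]

theorem count_D_zetaBlock_zero (a : List ℕ) : (zetaBlock a 0).count D = 0 := by
  induction a with
  | nil => simp [zetaBlock]
  | cons v a ih =>
    rw [zetaBlock, List.filterMap_cons]
    rw [zetaBlock] at ih
    by_cases h : v = 0
    · simp only [h, if_true, List.count_cons, ih]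
      simp
    · simpa only [h, if_false, Nat.add_eq_zero_iff, one_ne_zero, and_false] using ih

theorem count_D_zetaBlock_succ (a : List ℕ) (k : ℕ) :
    (zetaBlock a (k + 1)).count D = a.count k := by
  induction a with
  | nil => simp [zetaBlock]
  | cons v a ih =>
    rw [zetaBlock, List.filterMap_cons, List.count_cons, ← ih, zetaBlock]
    by_cases h : v = k
    · simp [h]
    · by_cases h' : v = k + 1 <;> simp [h, h']

theorem count_zeta_range (a : List ℕ) (m : ℕ) :
    ((List.range (m + 1)).flatMap (zetaBlock a)).count U =
      ((List.range (m + 1)).flatMap (zetaBlock a)).count D + a.count m := by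
  induction m with
  | zero => simp [count_U_zetaBlock, count_D_zetaBlock_zero]
  | succ m ih =>
    rw [List.range_succ, List.flatMap_append, List.count_append, List.count_append, ih]
    simp [count_U_zetaBlock, count_D_zetaBlock_succ]

theorem count_take_zeta_range (a : List ℕ) (m i : ℕ) :
    (((List.range m).flatMap (zetaBlock a)).take i).count D ≤
      (((List.range m).flatMap (zetaBlock a)).take i).count U := by
  induction m with
  | zero => simp
  | succ m ih =>
    rw [List.range_succ, List.flatMap_append, List.take_append, List.count_append,
      List.count_append]
    simp only [List.flatMap_cons, List.flatMap_nil, List.append_nil]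
    set L := (List.range m).flatMap (zetaBlock a) with hL
    by_cases hi : i ≤ L.length
    · simpa [Nat.sub_eq_zero_of_le hi] using ih
    · rw [List.take_of_length_le (by omega)]
      have h1 : ((zetaBlock a m).take (i - L.length)).count D ≤ (zetaBlock a m).count D :=
        (List.take_sublist _ _).count_le _
      rcases m with _ | m
      · rw [count_D_zetaBlock_zero] at h1
        have : L = [] := by simp [hL]
        rw [this]
        simp only [List.count_nil, List.length_nil, this] at h1 ⊢
        omega
      · rw [count_D_zetaBlock_succ] at h1
        have h2 := count_zeta_range a m
        rw [← hL] at h2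
        omega

theorem sum_count_range (a : List ℕ) (m : ℕ) (h : ∀ v ∈ a, v < m) :
    ((List.range m).map fun k => a.count k).sum = a.length := by
  induction a with
  | nil => simp
  | cons v a ih =>
    have hv : v < m := h v (by simp)
    have := ih fun w hw => h w (by simp [hw])
    simp only [List.count_cons, List.sum_map_add, this, List.length_cons]
    congr 1
    have h1 : ∀ m', ((List.range m').map fun i => if (v == i) = true then 1 else 0).sum =
        if v < m' then 1 else 0 := by
      intro m'
      induction m' with
      | zero => simp
      | succ m' ih' =>
        rw [List.range_succ, List.map_append, List.sum_append, ih']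
        simp only [List.map_cons, List.map_nil, List.sum_cons, List.sum_nil, beq_iff_eq]
        split_ifs <;> omega
    rw [h1 m, if_pos hv]

theorem count_U_zetaList (a : List ℕ) (h : ∀ v ∈ a, v < a.length) :
    (zetaList a).count U = a.length := by
  rw [zetaList, List.count_flatMap]
  refine Eq.trans ?_
    (sum_count_range a (a.length + 1) fun v hv => (h v hv).trans (Nat.lt_succ_self _))
  congr 1
  refine List.map_congr_left fun k _ => ?_
  simp [count_U_zetaBlock]

theorem lt_of_mem_areaList {n : ℕ} (p : DyckPath n) :
    ∀ v ∈ areaList p.1, v < (areaList p.1).length := by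
  intro v hv
  have := lt_of_mem_areaFrom 0 0 _ v hv
  rw [areaList, length_areaFrom]
  omega

/-- The zeta map of `q,t`-Catalan combinatorics on Dyck paths of size `n`. -/
def zeta (n : ℕ) (p : DyckPath n) : DyckPath n :=
  ⟨{ toList := zetaList (areaList p.1)
     count_U_eq_count_D := by
      have h : (areaList p.1).count (areaList p.1).length = 0 :=
        List.count_eq_zero_of_not_mem fun h => lt_irrefl _ (lt_of_mem_areaList p _ h)
      rw [zetaList, count_zeta_range, h, Nat.add_zero]
     count_D_le_count_U := fun i => count_take_zeta_range _ _ i },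
   (count_U_zetaList _ (lt_of_mem_areaList p)).trans (length_areaList p)⟩

/-! ### Unit interval posets -/

/-- The partial order on `Fin n` given by a set `S` of reals `x_1 < ⋯ < x_n`: the element `i` is
strictly below `j` if and only if `x_i + 1 < x_j`. -/
@[reducible]
noncomputable def startOrder {n : ℕ} (S : Finset ℝ) (h : S.card = n) : PartialOrder (Fin n) where
  le i j := i = j ∨ S.orderEmbOfFin h i + 1 < S.orderEmbOfFin h j
  lt i j := S.orderEmbOfFin h i + 1 < S.orderEmbOfFin h j
  le_refl _ := Or.inl rfl
  le_trans i j k := by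
    rintro (rfl | hij) (rfl | hjk)
    · exact Or.inl rfl
    · exact Or.inr hjk
    · exact Or.inr hij
    · exact Or.inr (by linarith)
  le_antisymm i j := by
    rintro (rfl | hij) (h' | hjk)
    · rfl
    · rfl
    · exact h'.symm
    · linarith
  lt_iff_le_not_ge i j := by
    constructor
    · intro hij
      refine ⟨Or.inr hij, ?_⟩
      rintro (rfl | hji) <;> linarith
    · rintro ⟨rfl | hij, h'⟩
      · exact absurd (Or.inl rfl) h'
      · exact hij

/-- `S` is a starting set of the poset `P`: it has `n` elements, and `P` is isomorphic to the
poset given by `S`. -/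
def IsStartingSet {n : ℕ} (S : Finset ℝ) (P : PartialOrder (Fin n)) : Prop :=
  ∃ h : S.card = n, Nonempty (P.le ≃r (startOrder S h).le)

/-- A unit interval order on the set `Fin n`. -/
structure UnitIntervalOrder (n : ℕ) where
  order : PartialOrder (Fin n)
  exists_startingSet : ∃ S : Finset ℝ, IsStartingSet S order

/-- Isomorphism of unit interval orders. -/
instance unitIntervalSetoid (n : ℕ) : Setoid (UnitIntervalOrder n) where
  r P Q := Nonempty (P.order.le ≃r Q.order.le)
  iseqv :=
    ⟨fun _ => ⟨RelIso.refl _⟩, fun ⟨e⟩ => ⟨e.symm⟩, fun ⟨e⟩ ⟨f⟩ => ⟨e.trans f⟩⟩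

/-- Unit interval posets with `n` elements (up to isomorphism). -/
abbrev UnitIntervalPoset (n : ℕ) : Type := Quotient (unitIntervalSetoid n)

/-! ### From unit interval posets to Dyck paths -/

/-- The set `S⁺ = {x + 1 | x ∈ S}`. -/
noncomputable def shift (S : Finset ℝ) : Finset ℝ := S.image (· + 1)

open Classical in
/-- The list of elements `y` of `S ∪ S⁺` in increasing order, with a north step written for
`y ∈ S` and an east step for the other `y`. -/
noncomputable def intervalList (S : Finset ℝ) : List DyckStep :=
  ((S ∪ shift S).sort (· ≤ ·)).map fun y => if y ∈ S then U else D

open Classical in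
theorem count_U_map (S : Finset ℝ) (l : List ℝ) (hl : l.Nodup) :
    (l.map fun y => if y ∈ S then U else D).count U = (l.toFinset.filter (· ∈ S)).card := by
  induction l with
  | nil => simp
  | cons y l ih =>
    rw [List.nodup_cons] at hl
    by_cases hy : y ∈ S
    · simp [hy, ih hl.2, Finset.filter_insert, hl.1]
    · simp [hy, ih hl.2, Finset.filter_insert]

open Classical in
theorem count_D_map (S : Finset ℝ) (l : List ℝ) (hl : l.Nodup) :
    (l.map fun y => if y ∈ S then U else D).count D = (l.toFinset.filter (· ∉ S)).card := by
  induction l with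
  | nil => simp
  | cons y l ih =>
    rw [List.nodup_cons] at hl
    by_cases hy : y ∈ S
    · simp [hy, ih hl.2, Finset.filter_insert]
    · simp [hy, ih hl.2, Finset.filter_insert, hl.1]

theorem count_U_intervalList (S : Finset ℝ) : (intervalList S).count U = S.card := by
  classical
  rw [intervalList, count_U_map _ _ (Finset.sort_nodup _ _)]
  congr 1
  ext y
  simp

theorem count_D_intervalList (S : Finset ℝ) (hS : Disjoint S (shift S)) :
    (intervalList S).count D = S.card := by
  classical
  rw [intervalList, count_D_map _ _ (Finset.sort_nodup _ _)]
  have : S.card = (shift S).card :=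
    (Finset.card_image_of_injective _ (add_left_injective (1 : ℝ))).symm
  rw [this]
  congr 1
  ext y
  have hd : y ∈ S → y ∉ shift S := fun hy => Finset.disjoint_left.1 hS hy
  simp only [Finset.sort_toFinset, Finset.mem_filter, Finset.mem_union]
  tauto

theorem count_take_intervalList (S : Finset ℝ) (i : ℕ) :
    ((intervalList S).take i).count D ≤ ((intervalList S).take i).count U := by
  classical
  rw [intervalList, ← List.map_take]
  set l := (S ∪ shift S).sort (· ≤ ·) with hl
  have hnd : l.Nodup := Finset.sort_nodup _ _
  have hsort : l.Pairwise (· ≤ ·) := Finset.pairwise_sort _ _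
  have hmem : ∀ y, y ∈ l ↔ y ∈ S ∪ shift S := fun y => Finset.mem_sort _
  have htn : (l.take i).Nodup := hnd.sublist (List.take_sublist _ _)
  rw [count_D_map _ _ htn, count_U_map _ _ htn]
  refine Finset.card_le_card_of_injOn (fun y => y - 1) ?_ ?_
  · intro y hy
    simp only [Finset.coe_filter, List.mem_toFinset, Set.mem_ofPred_eq] at hy ⊢
    have hyl : y ∈ S ∪ shift S := (hmem y).1 (List.mem_of_mem_take hy.1)
    have hy1 : y - 1 ∈ S := by
      rcases Finset.mem_union.1 hyl with h | h
      · exact absurd h hy.2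
      · obtain ⟨z, hz, rfl⟩ := Finset.mem_image.1 h
        simpa using hz
    refine ⟨?_, hy1⟩
    have h1 : y - 1 ∈ l := (hmem _).2 (Finset.mem_union_left _ hy1)
    rw [← List.take_append_drop i l, List.mem_append] at h1
    rcases h1 with h1 | h1
    · exact h1
    · rw [← List.take_append_drop i l, List.pairwise_append] at hsort
      have := hsort.2.2 y hy.1 _ h1
      linarith
  · intro y _ z _ h
    simpa using h

/-- The Dyck path of a set `S` of `n` reals with `S ∩ S⁺ = ∅`. -/
noncomputable def intervalPath {n : ℕ} (S : Finset ℝ) (h : S.card = n)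
    (hS : Disjoint S (shift S)) : DyckPath n :=
  ⟨{ toList := intervalList S
     count_U_eq_count_D := by rw [count_U_intervalList, count_D_intervalList S hS]
     count_D_le_count_U := count_take_intervalList S },
   (count_U_intervalList S).trans h⟩

theorem orderEmb_lt_iff {n : ℕ} {S S' : Finset ℝ} (h : S.card = n) (h' : S'.card = n)
    (e : (startOrder S h).le ≃r (startOrder S' h').le) (i j : Fin n) :
    S.orderEmbOfFin h i + 1 < S.orderEmbOfFin h j ↔
      S'.orderEmbOfFin h' (e i) + 1 < S'.orderEmbOfFin h' (e j) := by
  have key : ∀ (T : Finset ℝ) (hT : T.card = n) (i j : Fin n),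
      T.orderEmbOfFin hT i + 1 < T.orderEmbOfFin hT j ↔
        (startOrder T hT).le i j ∧ ¬ i = j := by
    intro T hT i j
    constructor
    · intro hij
      refine ⟨Or.inr hij, ?_⟩
      rintro rfl
      linarith
    · rintro ⟨hij | hij, hne⟩
      · exact absurd hij hne
      · exact hij
  rw [key, key, e.map_rel_iff, e.injective.eq_iff]

/-- The sorted labellings of two isomorphic posets given by starting sets agree. -/
theorem startOrder_unique {n : ℕ} {S S' : Finset ℝ} (h : S.card = n) (h' : S'.card = n)
    (e : (startOrder S h).le ≃r (startOrder S' h').le) (i j : Fin n) :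
    S.orderEmbOfFin h i + 1 < S.orderEmbOfFin h j ↔
      S'.orderEmbOfFin h' i + 1 < S'.orderEmbOfFin h' j := by
  let up : ∀ (T : Finset ℝ), T.card = n → Fin n → Finset (Fin n) := fun T hT i =>
    Finset.univ.filter fun j => T.orderEmbOfFin hT i + 1 < T.orderEmbOfFin hT j
  have hanti : ∀ (T : Finset ℝ) (hT : T.card = n) (i j : Fin n), i ≤ j →
      (up T hT j).card ≤ (up T hT i).card := by
    intro T hT i j hij
    refine Finset.card_le_card fun k hk => ?_
    have := (T.orderEmbOfFin hT).monotone hij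
    simp only [up, Finset.mem_filter, Finset.mem_univ, true_and] at hk ⊢
    linarith
  have hcard : ∀ i, (up S h i).card = (up S' h' (e i)).card := by
    intro i
    refine Finset.card_bij (fun j _ => e j) ?_ (fun _ _ _ _ hab => e.injective hab) ?_
    · intro j hj
      simp only [up, Finset.mem_filter, Finset.mem_univ, true_and] at hj ⊢
      exact (orderEmb_lt_iff h h' e i j).1 hj
    · intro j hj
      refine ⟨e.symm j, ?_, by simp⟩
      simp only [up, Finset.mem_filter, Finset.mem_univ, true_and] at hj ⊢
      rw [orderEmb_lt_iff h h' e]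
      simpa using hj
  have hu : ∀ i, (up S h i).card = (up S' h' i).card := by
    let f : Fin n → ℕᵒᵈ := fun i => OrderDual.toDual (up S' h' i).card
    have h1 : Monotone (f ∘ e.toEquiv) := by
      intro a b hab
      have := hanti S h a b hab
      rw [hcard, hcard] at this
      exact this
    have h2 : Monotone (f ∘ Equiv.refl (Fin n)) := fun a b hab => hanti S' h' a b hab
    have h3 := Tuple.unique_monotone h1 h2
    intro i
    rw [hcard]
    exact congrFun h3 i
  have hupper : ∀ (T : Finset ℝ) (hT : T.card = n) (i : Fin n),
      IsUpperSet (up T hT i : Set (Fin n)) := by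
    intro T hT i a b hab ha
    have := (T.orderEmbOfFin hT).monotone hab
    simp only [up, Finset.coe_filter, Finset.mem_univ, true_and, Set.mem_ofPred_eq] at ha ⊢
    linarith
  have heq : up S h i = up S' h' i := by
    rcases (hupper S h i).total (hupper S' h' i) with hs | hs
    · exact Finset.eq_of_subset_of_card_le (Finset.coe_subset.1 hs) (hu i).ge
    · exact (Finset.eq_of_subset_of_card_le (Finset.coe_subset.1 hs) (hu i).le).symm
  have := congrArg (fun s => j ∈ s) heq
  simpa [up] using this

/-- The Dyck path does not depend on the choice of the starting set. -/
theorem intervalPath_eq {n : ℕ} {S S' : Finset ℝ} (h : S.card = n) (h' : S'.card = n)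
    (hS : Disjoint S (shift S)) (hS' : Disjoint S' (shift S'))
    (e : (startOrder S h).le ≃r (startOrder S' h').le) :
    intervalPath S h hS = intervalPath S' h' hS' := by
  classical
  have hne : ∀ (T : Finset ℝ) (hT : T.card = n) (_ : Disjoint T (shift T)) (i j : Fin n),
      T.orderEmbOfFin hT i + 1 ≠ T.orderEmbOfFin hT j := by
    intro T hT hd i j hij
    refine Finset.disjoint_left.1 hd (T.orderEmbOfFin_mem hT j) ?_
    rw [← hij]
    exact Finset.mem_image_of_mem _ (T.orderEmbOfFin_mem hT i)
  let F : ∀ (T : Finset ℝ), T.card = n → Fin n ⊕ Fin n → ℝ := fun T hT =>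
    Sum.elim (fun i => T.orderEmbOfFin hT i) (fun i => T.orderEmbOfFin hT i + 1)
  have hinj : ∀ (T : Finset ℝ) (hT : T.card = n) (_ : Disjoint T (shift T)),
      Function.Injective (F T hT) := by
    rintro T hT hd (i | i) (j | j) hij
    · exact congrArg Sum.inl ((T.orderEmbOfFin hT).injective hij)
    · exact absurd hij.symm (hne T hT hd j i)
    · exact absurd hij (hne T hT hd i j)
    · exact congrArg Sum.inr ((T.orderEmbOfFin hT).injective (add_left_injective 1 hij))
  have himage : ∀ (T : Finset ℝ) (hT : T.card = n),
      T ∪ shift T = Finset.univ.image (F T hT) := by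
    intro T hT
    have hr : ∀ z, z ∈ T ↔ ∃ i, T.orderEmbOfFin hT i = z := by
      intro z
      rw [← Set.mem_range, Finset.range_orderEmbOfFin, Finset.mem_coe]
    ext y
    simp only [shift, Finset.mem_union, Finset.mem_image, Finset.mem_univ, true_and,
      Sum.exists, F, Sum.elim_inl, Sum.elim_inr, hr]
    constructor
    · rintro (hy | ⟨z, ⟨i, rfl⟩, hz⟩)
      · exact Or.inl hy
      · exact Or.inr ⟨i, hz⟩
    · rintro (hy | ⟨i, hz⟩)
      · exact Or.inl hy
      · exact Or.inr ⟨_, ⟨i, rfl⟩, hz⟩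
  have hlt : ∀ a b, F S h a < F S h b → F S' h' a < F S' h' b := by
    rintro (i | i) (j | j) hij
    · exact (S'.orderEmbOfFin h').strictMono ((S.orderEmbOfFin h).lt_iff_lt.1 hij)
    · have h1 : ¬ S.orderEmbOfFin h j + 1 < S.orderEmbOfFin h i := not_lt.2 (le_of_lt hij)
      rw [startOrder_unique h h' e] at h1
      exact lt_of_le_of_ne (not_lt.1 h1) (hne S' h' hS' j i).symm
    · exact (startOrder_unique h h' e i j).1 hij
    · have h1 : S.orderEmbOfFin h i < S.orderEmbOfFin h j := by
        simpa [F] using hij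
      have h2 := (S'.orderEmbOfFin h').strictMono ((S.orderEmbOfFin h).lt_iff_lt.1 h1)
      simpa [F] using h2
  let g : ℝ → ℝ := Function.extend (F S h) (F S' h') (fun _ => 0)
  have hg : ∀ a, g (F S h a) = F S' h' a := fun a => (hinj S h hS).extend_apply _ _ a
  have hmono : StrictMonoOn g (S ∪ shift S : Finset ℝ) := by
    rw [himage S h]
    intro y hy z hz hyz
    simp only [Finset.coe_image, Finset.coe_univ, Set.image_univ, Set.mem_range] at hy hz
    obtain ⟨a, rfl⟩ := hy
    obtain ⟨b, rfl⟩ := hz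
    rw [hg, hg]
    exact hlt a b hyz
  have himg : (S ∪ shift S).image g = S' ∪ shift S' := by
    rw [himage S h, himage S' h', Finset.image_image]
    exact Finset.image_congr fun a _ => hg a
  have hlab : ∀ (T : Finset ℝ) (hT : T.card = n) (_ : Disjoint T (shift T)) a,
      F T hT a ∈ T ↔ a.isLeft = true := by
    rintro T hT hd (i | i)
    · simp [F]
    · simp only [F, Sum.elim_inr, Sum.isLeft_inr, Bool.false_eq_true, iff_false]
      intro hmem
      exact Finset.disjoint_left.1 hd hmem
        (Finset.mem_image_of_mem _ (T.orderEmbOfFin_mem hT i))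
  refine Subtype.ext (DyckWord.ext ?_)
  change intervalList S = intervalList S'
  have hsort : (S' ∪ shift S').sort (· ≤ ·) = ((S ∪ shift S).sort (· ≤ ·)).map g := by
    rw [← himg, ← Finset.sort_val, ← Finset.sort_val, Finset.image_val_of_injOn hmono.injOn]
    exact (Multiset.map_sort _ _ _ _ fun a ha b hb => (hmono.le_iff_le ha hb).symm).symm
  rw [intervalList, intervalList, hsort, List.map_map]
  refine List.map_congr_left fun y hy => ?_
  rw [Finset.mem_sort, himage S h] at hy
  obtain ⟨a, -, rfl⟩ := Finset.mem_image.1 hy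
  simp only [Function.comp, hg, hlab S h hS, hlab S' h' hS']

/-- A poset is a unit interval order if its elements can be represented by unit intervals with
pairwise distinct starting points. -/
theorem isStartingSet_of_injective {n : ℕ} (P : PartialOrder (Fin n)) (x : Fin n → ℝ)
    (hx : Function.Injective x) (hP : ∀ i j, P.le i j ↔ i = j ∨ x i + 1 < x j) :
    IsStartingSet (Finset.univ.image x) P := by
  set S := Finset.univ.image x with hS
  have h : S.card = n := by
    rw [hS, Finset.card_image_of_injective _ hx]
    simp
  have hmem : ∀ i, x i ∈ S := fun i => Finset.mem_image_of_mem _ (Finset.mem_univ i)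
  let k : Fin n → Fin n := fun i => (S.orderIsoOfFin h).symm ⟨x i, hmem i⟩
  have hk : ∀ i, S.orderEmbOfFin h (k i) = x i := by
    intro i
    rw [← Finset.coe_orderIsoOfFin_apply]
    simp [k]
  have hinj : Function.Injective k := by
    intro i j hij
    apply hx
    rw [← hk i, ← hk j, hij]
  refine ⟨h, ⟨⟨Equiv.ofBijective k (Finite.injective_iff_bijective.1 hinj), ?_⟩⟩⟩
  intro i j
  change (k i = k j ∨ S.orderEmbOfFin h (k i) + 1 < S.orderEmbOfFin h (k j)) ↔ P.le i j
  rw [hk, hk, hinj.eq_iff, hP]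

/-- A unit interval order has a starting set `S` with `S ∩ S⁺ = ∅`. -/
theorem exists_disjoint_startingSet {n : ℕ} (P : UnitIntervalOrder n) :
    ∃ S : Finset ℝ, IsStartingSet S P.order ∧ Disjoint S (shift S) := by
  classical
  obtain ⟨S, h, ⟨e⟩⟩ := P.exists_startingSet
  let z : Fin n → ℝ := fun i => S.orderEmbOfFin h (e i)
  have hz : Function.Injective z := fun i j hij =>
    e.injective ((S.orderEmbOfFin h).injective hij)
  have hle : ∀ i j, P.order.le i j ↔ i = j ∨ z i + 1 < z j := by
    intro i j
    rw [← e.map_rel_iff, ← e.injective.eq_iff (a := i)]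
    exact Iff.rfl
  have hev : ∀ᶠ c : ℝ in nhdsWithin 1 (Set.Iio 1),
      ∀ i j, 1 < z j - z i → 1 < c * (z j - z i) := by
    refine Filter.eventually_all.2 fun i => Filter.eventually_all.2 fun j => ?_
    by_cases hd : 1 < z j - z i
    · have hc : Continuous fun c : ℝ => c * (z j - z i) := by fun_prop
      have := (hc.tendsto 1).eventually (lt_mem_nhds (a := 1) (by simpa using hd))
      exact (this.filter_mono nhdsWithin_le_nhds).mono fun c hc _ => hc
    · exact Filter.Eventually.of_forall fun c hc => absurd hc hd
  have h01 : ∀ᶠ c : ℝ in nhdsWithin 1 (Set.Iio 1), c ∈ Set.Ioo (0 : ℝ) 1 :=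
    Ioo_mem_nhdsLT one_pos
  obtain ⟨c, hc, hc0, hc1⟩ := (hev.and h01).exists
  have hsmall : ∀ i j, ¬ 1 < z j - z i → c * (z j - z i) < 1 := by
    intro i j hd
    nlinarith
  refine ⟨Finset.univ.image fun i => c * z i, ?_, ?_⟩
  · refine isStartingSet_of_injective _ _ (fun i j hij => hz (mul_left_cancel₀ hc0.ne' hij)) ?_
    intro i j
    rw [hle]
    refine or_congr Iff.rfl ⟨fun hd => ?_, fun hd => ?_⟩
    · have := hc i j (by linarith)
      linarith
    · by_contra hn
      have := hsmall i j (fun hd' => hn (by linarith))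
      linarith
  · rw [Finset.disjoint_left]
    intro y hy hy'
    simp only [shift, Finset.mem_image, Finset.mem_univ, true_and] at hy hy'
    obtain ⟨j, rfl⟩ := hy
    obtain ⟨_, ⟨i, rfl⟩, hij⟩ := hy'
    by_cases hd : 1 < z j - z i
    · have := hc i j hd
      linarith
    · have := hsmall i j hd
      linarith

/-- The map `φ` on unit interval orders: choose a starting set `S` with `S ∩ S⁺ = ∅`, and read
off the steps from `S ∪ S⁺`. -/
noncomputable def phiOrder {n : ℕ} (P : UnitIntervalOrder n) : DyckPath n :=
  intervalPath (exists_disjoint_startingSet P).choose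
    (exists_disjoint_startingSet P).choose_spec.1.choose
    (exists_disjoint_startingSet P).choose_spec.2

/-- The value of `φ` can be computed from any starting set `S` with `S ∩ S⁺ = ∅`. -/
theorem phiOrder_eq {n : ℕ} (P : UnitIntervalOrder n) (S : Finset ℝ) (h : S.card = n)
    (e : Nonempty (P.order.le ≃r (startOrder S h).le)) (hS : Disjoint S (shift S)) :
    phiOrder P = intervalPath S h hS :=
  intervalPath_eq _ _ _ _
    ((exists_disjoint_startingSet P).choose_spec.1.choose_spec.some.symm.trans e.some)

/-- The map `φ` from unit interval posets to Dyck paths. -/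
noncomputable def phi (n : ℕ) : UnitIntervalPoset n → DyckPath n :=
  Quotient.lift phiOrder fun P Q ⟨e⟩ => by
    obtain ⟨S, ⟨h, ⟨f⟩⟩, hS⟩ := exists_disjoint_startingSet Q
    rw [phiOrder_eq P S h ⟨e.trans f⟩ hS, phiOrder_eq Q S h ⟨f⟩ hS]

/-! ### From Dyck paths to unit interval posets -/

/-- The partial order on `Fin n` given by the area vector of a Dyck path: `i ≺ j` if and only if
either `a_i + 2 ≤ a_j`, or `a_i + 1 = a_j` and `i < j`. -/
@[reducible]
def psiOrder {n : ℕ} (p : DyckPath n) : PartialOrder (Fin n) where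
  le i j := i = j ∨ area p i + 2 ≤ area p j ∨ (area p i + 1 = area p j ∧ i < j)
  lt i j := area p i + 2 ≤ area p j ∨ (area p i + 1 = area p j ∧ i < j)
  le_refl _ := Or.inl rfl
  le_trans i j k := by
    rintro (rfl | hij) (rfl | hjk)
    · exact Or.inl rfl
    · exact Or.inr hjk
    · exact Or.inr hij
    · exact Or.inr (Or.inl (by omega))
  le_antisymm i j := by
    rintro (rfl | hij) (h' | hjk)
    · rfl
    · rfl
    · exact h'.symm
    · omega
  lt_iff_le_not_ge i j := by
    constructor
    · intro hij
      refine ⟨Or.inr hij, ?_⟩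
      rintro (rfl | hji) <;> omega
    · rintro ⟨rfl | hij, h'⟩
      · exact absurd (Or.inl rfl) h'
      · exact hij

theorem psiOrder_isUnitInterval {n : ℕ} (p : DyckPath n) :
    ∃ S : Finset ℝ, IsStartingSet S (psiOrder p) := by
  let t : Fin n → ℝ := fun i => (i : ℝ) / n
  have hn : ∀ i : Fin n, (0 : ℝ) < n := fun i => by exact_mod_cast i.pos
  have ht0 : ∀ i, 0 ≤ t i := fun i => by positivity
  have ht1 : ∀ i, t i < 1 := fun i => by
    rw [div_lt_one (hn i)]
    exact_mod_cast i.2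
  have htlt : ∀ i j, t i < t j ↔ i < j := fun i j => by
    rw [div_lt_div_iff_of_pos_right (hn i)]
    simp
  refine ⟨_, isStartingSet_of_injective _ (fun i => (area p i : ℝ) + t i) ?_ ?_⟩
  · intro i j hij
    simp only at hij
    have h1 : area p i < area p j + 1 := by
      have := ht0 i
      have := ht1 j
      exact_mod_cast (by linarith : (area p i : ℝ) < area p j + 1)
    have h2 : area p j < area p i + 1 := by
      have := ht0 j
      have := ht1 i
      exact_mod_cast (by linarith : (area p j : ℝ) < area p i + 1)
    have h3 : area p i = area p j := by omega
    rw [h3] at hij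
    have h4 : t i = t j := by linarith
    exact le_antisymm (not_lt.1 fun h => ((htlt j i).2 h).ne h4.symm)
      (not_lt.1 fun h => ((htlt i j).2 h).ne h4)
  · intro i j
    refine or_congr Iff.rfl ⟨?_, fun h => ?_⟩
    · rintro (h | ⟨h, hij⟩)
      · have h' : (area p i : ℝ) + 2 ≤ area p j := by exact_mod_cast h
        have := ht0 j
        have := ht1 i
        linarith
      · have h' : (area p i : ℝ) + 1 = area p j := by exact_mod_cast h
        have := (htlt i j).2 hij
        linarith
    · have h1 : area p i < area p j := by
        have := ht0 i
        have := ht1 j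
        exact_mod_cast (by linarith : (area p i : ℝ) < area p j)
      by_cases h2 : area p i + 2 ≤ area p j
      · exact Or.inl h2
      · have h3 : area p i + 1 = area p j := by omega
        have h' : (area p i : ℝ) + 1 = area p j := by exact_mod_cast h3
        exact Or.inr ⟨h3, (htlt i j).1 (by linarith)⟩

/-- The map `ψ` from Dyck paths to unit interval posets. -/
def psi (n : ℕ) (p : DyckPath n) : UnitIntervalPoset n :=
  Quotient.mk _ ⟨psiOrder p, psiOrder_isUnitInterval p⟩

end UnitInterval

/-!
The poset `ψ(D)` of a Dyck path `D` with area vector `a` is represented by the unit intervals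
starting at `x i = a i + t i`, where `0 ≤ t i < 1` and `t` increases with `i`: the integer parts
decide all comparisons except those with `a i + 1 = a j`, which the fractional parts decide
according to the order of `i` and `j` (`isStartingSet_startingPoints`). The fractional parts also
keep `S` and `S⁺` apart, so that `φ(ψ(D))` can be read off from this particular `S`.

A point of `S ∪ S⁺` in `[k, k + 1)` is `k + t i`, where either `a i = k` and the point lies in
`S`, or `a i + 1 = k` and the point lies in `S⁺`. Inside `[k, k + 1)` these points are ordered by
`i`, so running through them is the `k`-th reading of the area vector in the definition of the
zeta map, and taking `k = 0, 1, …, n` in this order sorts `S ∪ S⁺`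
(`sort_startingPoints_union_shift`).
-/

namespace UnitInterval

open DyckStep

variable {n : ℕ}

/-- The points `a i + t i`. Here `a` is an area vector, and `t` a strictly increasing family in
`[0, 1)`. -/
noncomputable def startingPoints (a : Fin n → ℕ) (t : Fin n → ℝ) : Finset ℝ :=
  Finset.univ.image fun i => (a i : ℝ) + t i

theorem natCast_add_inj {t : Fin n → ℝ} (ht : StrictMono t) (ht01 : ∀ i, t i ∈ Set.Ico 0 1)
    {k l : ℕ} {i j : Fin n} : (k : ℝ) + t i = l + t j ↔ k = l ∧ i = j := by
  refine ⟨fun h => ?_, fun ⟨hk, hi⟩ => by rw [hk, hi]⟩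
  have hi := ht01 i
  have hj := ht01 j
  have h1 : k < l + 1 := by exact_mod_cast (by linarith [hi.1, hj.2] : (k : ℝ) < l + 1)
  have h2 : l < k + 1 := by exact_mod_cast (by linarith [hj.1, hi.2] : (l : ℝ) < k + 1)
  obtain rfl : k = l := by omega
  exact ⟨rfl, ht.injective (add_left_cancel h)⟩

theorem natCast_add_lt {t : Fin n → ℝ} (ht : StrictMono t) (ht01 : ∀ i, t i ∈ Set.Ico 0 1)
    {k l : ℕ} {i j : Fin n} : (k : ℝ) + t i < l + t j ↔ k < l ∨ k = l ∧ i < j := by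
  have hi := ht01 i
  have hj := ht01 j
  rcases lt_trichotomy k l with h | rfl | h
  · have h' : (k : ℝ) + 1 ≤ l := by exact_mod_cast h
    exact iff_of_true (by linarith [hi.2, hj.1]) (Or.inl h)
  · simp [ht.lt_iff_lt]
  · have h' : (l : ℝ) + 1 ≤ k := by exact_mod_cast h
    exact iff_of_false (by linarith [hj.2, hi.1]) (by omega)

theorem natCast_add_mem_startingPoints {a : Fin n → ℕ} {t : Fin n → ℝ} (ht : StrictMono t)
    (ht01 : ∀ i, t i ∈ Set.Ico 0 1) {k : ℕ} {i : Fin n} :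
    (k : ℝ) + t i ∈ startingPoints a t ↔ a i = k := by
  simp [startingPoints, natCast_add_inj ht ht01]

theorem mem_shift_startingPoints {a : Fin n → ℕ} {t : Fin n → ℝ} {y : ℝ} :
    y ∈ shift (startingPoints a t) ↔ ∃ i, ((a i + 1 : ℕ) : ℝ) + t i = y := by
  simp only [shift, startingPoints, Finset.image_image, Finset.mem_image, Finset.mem_univ,
    true_and, Function.comp_apply, Nat.cast_add, Nat.cast_one, add_right_comm]

theorem disjoint_startingPoints_shift {a : Fin n → ℕ} {t : Fin n → ℝ} (ht : StrictMono t)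
    (ht01 : ∀ i, t i ∈ Set.Ico 0 1) :
    Disjoint (startingPoints a t) (shift (startingPoints a t)) := by
  refine Finset.disjoint_right.2 fun y hy => ?_
  obtain ⟨i, rfl⟩ := mem_shift_startingPoints.1 hy
  rw [natCast_add_mem_startingPoints ht ht01]
  omega

theorem isStartingSet_startingPoints (p : DyckPath n) {t : Fin n → ℝ} (ht : StrictMono t)
    (ht01 : ∀ i, t i ∈ Set.Ico 0 1) : IsStartingSet (startingPoints (area p) t) (psiOrder p) := by
  refine isStartingSet_of_injective _ _
    (fun i j hij => ((natCast_add_inj ht ht01).1 hij).2) fun i j => or_congr Iff.rfl ?_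
  have h : (area p i : ℝ) + t i + 1 = ((area p i + 1 : ℕ) : ℝ) + t i := by push_cast; ring
  rw [h, natCast_add_lt ht ht01]
  omega

/-- The points of `S ∪ S⁺` in `[k, k + 1)` in increasing order, for `S = startingPoints a t`. -/
noncomputable def pointBlock (a : Fin n → ℕ) (t : Fin n → ℝ) (k : ℕ) : List ℝ :=
  ((List.finRange n).filter fun i => a i = k ∨ a i + 1 = k).map fun i => (k : ℝ) + t i

theorem mem_pointBlock {a : Fin n → ℕ} {t : Fin n → ℝ} {k : ℕ} {y : ℝ} :
    y ∈ pointBlock a t k ↔ ∃ i, (a i = k ∨ a i + 1 = k) ∧ (k : ℝ) + t i = y := by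
  simp [pointBlock]

theorem pairwise_lt_flatMap_pointBlock (a : Fin n → ℕ) {t : Fin n → ℝ} (ht : StrictMono t)
    (ht01 : ∀ i, t i ∈ Set.Ico 0 1) (m : ℕ) :
    ((List.range m).flatMap (pointBlock a t)).Pairwise (· < ·) := by
  refine List.pairwise_flatMap.2 ⟨fun k _ => ?_, List.pairwise_lt_range.imp ?_⟩
  · refine List.pairwise_map.2 (((List.pairwise_lt_finRange n).filter _).imp fun hij => ?_)
    exact (natCast_add_lt ht ht01).2 (Or.inr ⟨rfl, hij⟩)
  · intro k l hkl y hy z hz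
    obtain ⟨i, -, rfl⟩ := mem_pointBlock.1 hy
    obtain ⟨j, -, rfl⟩ := mem_pointBlock.1 hz
    exact (natCast_add_lt ht ht01).2 (Or.inl hkl)

/-- As all entries of `a` are less than `n`, the set `S ∪ S⁺` lies in `[0, n + 1)`, and the blocks
for `k = 0, …, n` exhaust it. -/
theorem sort_startingPoints_union_shift {a : Fin n → ℕ} (ha : ∀ i, a i < n) {t : Fin n → ℝ}
    (ht : StrictMono t) (ht01 : ∀ i, t i ∈ Set.Ico 0 1) :
    (startingPoints a t ∪ shift (startingPoints a t)).sort (· ≤ ·) =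
      (List.range (n + 1)).flatMap (pointBlock a t) := by
  have hlt := pairwise_lt_flatMap_pointBlock a ht ht01 (n + 1)
  have hset : startingPoints a t ∪ shift (startingPoints a t) =
      ((List.range (n + 1)).flatMap (pointBlock a t)).toFinset := by
    ext y
    simp only [Finset.mem_union, mem_shift_startingPoints, List.mem_toFinset, List.mem_flatMap,
      List.mem_range, mem_pointBlock]
    constructor
    · rintro (hy | ⟨i, rfl⟩)
      · obtain ⟨i, -, rfl⟩ := Finset.mem_image.1 hy
        exact ⟨a i, (ha i).trans n.lt_succ_self, i, Or.inl rfl, rfl⟩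
      · exact ⟨a i + 1, Nat.succ_lt_succ (ha i), i, Or.inr rfl, rfl⟩
    · rintro ⟨k, -, i, hi | rfl, rfl⟩
      · exact Or.inl ((natCast_add_mem_startingPoints ht ht01).2 hi)
      · exact Or.inr ⟨i, rfl⟩
  rw [hset]
  exact (List.toFinset_sort (· ≤ ·) (hlt.imp ne_of_lt)).2 (hlt.imp le_of_lt)

open Classical in
theorem map_pointBlock (a : Fin n → ℕ) {t : Fin n → ℝ} (ht : StrictMono t)
    (ht01 : ∀ i, t i ∈ Set.Ico 0 1) (k : ℕ) :
    ((pointBlock a t k).map fun y => if y ∈ startingPoints a t then U else D) =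
      zetaBlock (List.ofFn a) k := by
  rw [pointBlock, zetaBlock, List.ofFn_eq_map]
  induction List.finRange n with
  | nil => rfl
  | cons i l ih =>
    by_cases h : a i = k
    · simpa [h, natCast_add_mem_startingPoints ht ht01] using ih
    · by_cases h' : a i + 1 = k <;>
        simpa [h, h', natCast_add_mem_startingPoints ht ht01] using ih

theorem intervalList_startingPoints {a : Fin n → ℕ} (ha : ∀ i, a i < n) {t : Fin n → ℝ}
    (ht : StrictMono t) (ht01 : ∀ i, t i ∈ Set.Ico 0 1) :
    intervalList (startingPoints a t) = zetaList (List.ofFn a) := by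
  classical
  rw [intervalList, sort_startingPoints_union_shift ha ht ht01, List.map_flatMap, zetaList,
    List.length_ofFn]
  congr 1
  funext k
  convert map_pointBlock a ht ht01 k

theorem ofFn_area (p : DyckPath n) : List.ofFn (area p) = areaList p.1 :=
  List.ext_getElem (by simp [length_areaList]) fun i _ _ => by simp [area]

theorem area_lt (p : DyckPath n) (i : Fin n) : area p i < n :=
  (lt_of_mem_areaList p _ (List.getElem_mem _)).trans_eq (length_areaList p)

theorem exists_strictMono_mem_Ico (n : ℕ) :
    ∃ t : Fin n → ℝ, StrictMono t ∧ ∀ i, t i ∈ Set.Ico 0 1 := by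
  have hn : ∀ i : Fin n, (0 : ℝ) < n := fun i => by exact_mod_cast i.pos
  refine ⟨fun i => (i : ℝ) / n, fun i j hij => ?_, fun i => ⟨by positivity, ?_⟩⟩
  · exact div_lt_div_of_pos_right (by exact_mod_cast hij) (hn i)
  · rw [div_lt_one (hn i)]
    exact_mod_cast i.2

end UnitInterval

open UnitInterval in
theorem mainTheorem1 (n : ℕ) :
    UnitInterval.phi n ∘ UnitInterval.psi n = UnitInterval.zeta n := by
  funext p
  obtain ⟨t, ht, ht01⟩ := exists_strictMono_mem_Ico n
  obtain ⟨h, e⟩ := isStartingSet_startingPoints p ht ht01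
  refine (phiOrder_eq ⟨psiOrder p, psiOrder_isUnitInterval p⟩ _ h e
    (disjoint_startingPoints_shift ht ht01)).trans (Subtype.ext (DyckWord.ext ?_))
  change intervalList _ = zetaList _
  rw [intervalList_startingPoints (area_lt p) ht ht01, ofFn_area]
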